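/- All graphs are finite and simple, and $\log$ denotes the logarithm to base $2$. For $k \ge 1$, a graph is $k$-connected if it has at least $k+1$ vertices and contains no set of $k-1$ vertices whose removal disconnects it. For integers $k,n$ with $1 \le k \le n/2$, let $f(k,n)$ be the smallest integer $t$ such that every $t$-connected graph with $n$ vertices has a spanning bipartite $k$-connected subgraph. (a) For all integers $k,n$ with $1 \le k \le n/2$, $f(k,n) \le 22k^2\log n$. (b) For every real $0 \le \alpha < 1$ and all sufficiently large $n$ (depending on $\alpha$), if $k=\lfloor n^\alpha \rfloor$, then $f(k,n) \le 9n^{(1+\alpha)/2} \le 9\sqrt{n(k+1)}$. (c) For every real $0 < c < \frac12$ and all sufficiently large $n$ (depending on $c$), if $k=\lfloor cn \rfloor$, then $f(k,n) \le 30\sqrt{c}\,n \le 30\sqrt{n(k+1)}$. -/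

import Mathlib

/-- For `k ≥ 1`, a graph is `k`-connected if it has at least `k + 1` vertices and there is no set of
`k - 1` vertices whose removal disconnects it (the cardinality condition is written `#S + 1 = k`, to
avoid truncated subtraction). -/
def KConnected {V : Type*} [Fintype V] (k : ℕ) (G : SimpleGraph V) : Prop :=
  k + 1 ≤ Fintype.card V ∧
    ∀ S : Finset V, S.card + 1 = k → (G.induce {v : V | v ∉ S}).Connected

/-- `G` has a spanning bipartite `k`-connected subgraph (a spanning subgraph is a graph `H ≤ G` on
the same vertex set). -/
def HasSpanningBipartiteKConnected {V : Type*} [Fintype V] (k : ℕ) (G : SimpleGraph V) : Prop :=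
  ∃ H : SimpleGraph V, H ≤ G ∧ H.IsBipartite ∧ KConnected k H

/-- The set of all `t` such that every `t`-connected `n`-vertex graph has a spanning bipartite
`k`-connected subgraph. -/
def goodConnectivity (k n : ℕ) : Set ℕ :=
  {t : ℕ | ∀ G : SimpleGraph (Fin n), KConnected t G → HasSpanningBipartiteKConnected k G}

/-- `f k n` is the smallest `t` such that every `t`-connected `n`-vertex graph has a spanning
bipartite `k`-connected subgraph. -/
noncomputable def f (k n : ℕ) : ℕ := sInf (goodConnectivity k n)

/-- The set defining `f k n` is never empty, so that `f k n` is its minimum. -/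
theorem isLeast_f (k n : ℕ) : IsLeast (goodConnectivity k n) (f k n) := by
  have hne : (goodConnectivity k n).Nonempty := by
    refine ⟨n, fun G hG => ?_⟩
    have h := hG.1
    rw [Fintype.card_fin] at h
    omega
  exact ⟨Nat.sInf_mem hne, fun t ht => Nat.sInf_le ht⟩

/-! Take a 2-colouring of the vertices and a partition into pieces, each surviving the loss of fewer
than `k` vertices inside the bichromatic graph, each a single vertex or of size at least `L`, with
as few pieces as possible. Flipping the colours of a whole piece changes no edge inside it. So, if
one of two pieces is large, `2k - 1` suitably independent arcs between them would allow a merger: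
one of two relative flips makes `k` of them bichromatic (`IsOptimalLabelling.card_arcs_lt`). Yet
high connectivity sends many arcs out of every piece (`IsOptimalLabelling.exists_arcs`), unless
there is only one piece, which is the goal.

Logarithmic bound: these arcs are spread over many pieces, so random flips keep many bichromatic at
every piece at once (`exists_flips`). While a union of pieces can be separated, pass to the side
with fewer pieces; each piece there loses at most `k - 1` arcs, and there are at most `log n` rounds
(`exists_robustlyLinked_classUnion`). The surviving union has at least two pieces and contradicts
minimality.

Square root bounds: with `L = γ` and `γ² ≥ 2kn` there are at most `n / γ` large pieces, so a
singleton has at most `γ` neighbours in them. The singletons then induce a dense graph, and Mader's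
theorem in a good colouring of it yields a new large piece. Without singletons, there are too few
pieces to receive the arcs leaving one of them. -/

open Finset
open scoped Classical

/-! ### Robust linkedness, and merging along sturdy families of arcs -/

section Linked

variable {V : Type*}

/-- The bipartite subgraph of the edges of `G` whose ends have different colours. -/
def cutGraph (G : SimpleGraph V) (σ : V → Bool) : SimpleGraph V where
  Adj x y := G.Adj x y ∧ σ x ≠ σ y
  symm := ⟨fun _ _ h => ⟨h.1.symm, h.2.symm⟩⟩
  loopless := ⟨fun _ h => h.2 rfl⟩

/-- Every partition of `W` into two nonempty parts is crossed by an edge of `H`. -/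
def Linked (H : SimpleGraph V) (W : Finset V) : Prop :=
  ∀ p : V → Prop, (∃ x ∈ W, p x) → (∃ y ∈ W, ¬ p y) → ∃ x ∈ W, ∃ y ∈ W, p x ∧ ¬ p y ∧ H.Adj x y

theorem Linked.of_card_le_one {H : SimpleGraph V} {W : Finset V} (h : #W ≤ 1) : Linked H W := by
  rintro p ⟨x, hx, hpx⟩ ⟨y, hy, hpy⟩
  rw [card_le_one.1 h x hx y hy] at hpx
  exact absurd hpx hpy

variable [DecidableEq V]

/-- `U` stays linked after the removal of fewer than `k` vertices. -/
def RobustlyLinked (k : ℕ) (H : SimpleGraph V) (U : Finset V) : Prop :=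
  ∀ S : Finset V, #S < k → Linked H (U \ S)

theorem RobustlyLinked.of_card_le_one {k : ℕ} {H : SimpleGraph V} {U : Finset V} (h : #U ≤ 1) :
    RobustlyLinked k H U := fun _ _ =>
  .of_card_le_one ((card_le_card sdiff_subset).trans h)

/-- Robustness inside the bichromatic graph only depends on the colours up to a global flip. -/
theorem RobustlyLinked.congr {k : ℕ} {G : SimpleGraph V} {σ σ' : V → Bool} {U : Finset V}
    (h : RobustlyLinked k (cutGraph G σ) U)
    (hσ : ∀ x ∈ U, ∀ y ∈ U, σ x ≠ σ y → σ' x ≠ σ' y) : RobustlyLinked k (cutGraph G σ') U := by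
  intro S hS p hx hy
  obtain ⟨x, hx, y, hy, hpx, hpy, hxy⟩ := h S hS p hx hy
  exact ⟨x, hx, y, hy, hpx, hpy, hxy.1,
    hσ x (mem_sdiff.1 hx).1 y (mem_sdiff.1 hy).1 hxy.2⟩

/-- The definition removes exactly `t - 1` vertices, so a smaller `S` is first enlarged while
avoiding one chosen vertex on each side of the partition. -/
theorem KConnected.robustlyLinked [Fintype V] {t : ℕ} {G : SimpleGraph V} (h : KConnected t G) :
    RobustlyLinked t G univ := by
  rintro S hS p ⟨x, hx, hpx⟩ ⟨y, hy, hpy⟩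
  have hxy : x ≠ y := by rintro rfl; exact hpy hpx
  have hcard : #({x, y}ᶜ : Finset V) = Fintype.card V - 2 := by
    rw [card_compl, card_pair hxy]
  have h1 := h.1
  obtain ⟨S', hSS', hS'xy, hS'⟩ := exists_subsuperset_card_eq (s := S) (t := {x, y}ᶜ) (n := t - 1)
    (by
      intro z hz
      simp only [mem_compl, mem_insert, mem_singleton, not_or]
      exact ⟨fun e => (mem_sdiff.1 hx).2 (e ▸ hz), fun e => (mem_sdiff.1 hy).2 (e ▸ hz)⟩)
    (by omega) (by omega)
  have hc := h.2 S' (by omega)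
  have hxS : x ∉ S' := fun hz => by simpa using hS'xy hz
  have hyS : y ∉ S' := fun hz => by simpa using hS'xy hz
  obtain ⟨w⟩ := hc.preconnected ⟨x, hxS⟩ ⟨y, hyS⟩
  obtain ⟨d, -, hd1, hd2⟩ := w.exists_boundary_dart {v | p v} hpx hpy
  exact ⟨d.fst, by simpa using fun hz => d.fst.2 (hSS' hz), d.snd,
    by simpa using fun hz => d.snd.2 (hSS' hz), hd1, hd2, d.adj⟩

theorem KConnected.of_robustlyLinked [Fintype V] {k : ℕ} {H : SimpleGraph V} (hk : k + 1 ≤ Fintype.card V)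
    (h : RobustlyLinked k H univ) : KConnected k H := by
  refine ⟨hk, fun S hS => ?_⟩
  have hne : ∃ v, v ∉ S := by
    by_contra! hall
    have := card_le_card (fun v _ => hall v : (univ : Finset V) ⊆ S)
    rw [card_univ] at this
    omega
  obtain ⟨v₀, hv₀⟩ := hne
  have : Nonempty {v : V | v ∉ S} := ⟨⟨v₀, hv₀⟩⟩
  refine SimpleGraph.Connected.mk fun a b => ?_
  by_contra hab
  obtain ⟨x, hx, y, hy, ⟨hxS, hax⟩, hay, hxy⟩ := h S (by omega)
    (fun v => ∃ hv : v ∉ S, (H.induce {v : V | v ∉ S}).Reachable a ⟨v, hv⟩)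
    ⟨a, mem_sdiff.2 ⟨mem_univ _, a.2⟩, a.2, .refl _⟩
    ⟨b, mem_sdiff.2 ⟨mem_univ _, b.2⟩, fun ⟨_, hb⟩ => hab hb⟩
  have hyS : y ∉ S := (mem_sdiff.1 hy).2
  refine hay ⟨hyS, hax.trans (SimpleGraph.Adj.reachable ?_)⟩
  simpa using hxy

theorem hasSpanningBipartiteKConnected_of_cutGraph [Fintype V] {k : ℕ} {G : SimpleGraph V} {σ : V → Bool}
    (hk : k + 1 ≤ Fintype.card V) (h : RobustlyLinked k (cutGraph G σ) univ) :
    HasSpanningBipartiteKConnected k G := by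
  refine ⟨cutGraph G σ, fun _ _ h => h.1, ?_, .of_robustlyLinked hk h⟩
  have := (SimpleGraph.Coloring.mk (G := cutGraph G σ) σ fun h => h.2).colorable
  simpa [SimpleGraph.IsBipartite] using this

/-- The vertices of `X` cannot be separated from a sturdy family `E` of arcs leaving `X`: a set that
does not contain `X` meets at most as many arcs as it has elements. -/
def Sturdy (X : Finset V) (E : Finset (V × V)) : Prop :=
  ∀ S : Finset V, ¬ X ⊆ S → #{e ∈ E | e.1 ∈ S ∨ e.2 ∈ S} ≤ #S

theorem Sturdy.mono {X : Finset V} {E F : Finset (V × V)} (h : Sturdy X E) (hF : F ⊆ E) :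
    Sturdy X F := fun S hS =>
  (card_le_card (filter_subset_filter _ hF)).trans (h S hS)

/-- Charge each arc met by `S` to an end in `S`; tails lie in `X` and heads outside, so no vertex is
charged twice. -/
theorem Sturdy.of_matching {X : Finset V} {E : Finset (V × V)} (h1 : ∀ e ∈ E, e.1 ∈ X)
    (h2 : ∀ e ∈ E, e.2 ∉ X) (hi1 : Set.InjOn Prod.fst (E : Set (V × V)))
    (hi2 : Set.InjOn Prod.snd (E : Set (V × V))) : Sturdy X E := by
  intro S _
  refine card_le_card_of_injOn (fun e => if e.1 ∈ S then e.1 else e.2) ?_ ?_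
  · intro e he
    simp only [coe_filter, Set.mem_ofPred_eq] at he
    dsimp only
    split_ifs with h
    · exact h
    · exact he.2.resolve_left h
  · intro e he e' he' hee
    simp only [coe_filter, Set.mem_ofPred_eq] at he he'
    dsimp only at hee
    split_ifs at hee with h h' h'
    · exact hi1 he.1 he'.1 hee
    · exact absurd (h1 e he.1) (hee ▸ h2 e' he'.1)
    · exact absurd (h1 e' he'.1) (hee ▸ h2 e he.1)
    · exact hi2 he.1 he'.1 hee

theorem Sturdy.of_star {v : V} {E : Finset (V × V)} (h1 : ∀ e ∈ E, e.1 = v)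
    (hi : Set.InjOn Prod.snd (E : Set (V × V))) : Sturdy {v} E := by
  intro S hS
  rw [singleton_subset_iff] at hS
  refine card_le_card_of_injOn Prod.snd ?_ ?_
  · intro e he
    simp only [coe_filter, Set.mem_ofPred_eq] at he
    exact he.2.resolve_left (h1 e he.1 ▸ hS)
  · exact hi.mono fun e he => (mem_filter.1 he).1

/-- Either `S` swallows `X` and only `Y` matters, or sturdiness leaves an arc untouched by `S`,
which joins the two linked remainders. -/
theorem RobustlyLinked.union {k : ℕ} {H : SimpleGraph V} {X Y : Finset V} {E : Finset (V × V)}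
    (hX : RobustlyLinked k H X) (hY : RobustlyLinked k H Y) (hE : Sturdy X E)
    (hEX : ∀ e ∈ E, e.1 ∈ X ∧ e.2 ∈ Y ∧ H.Adj e.1 e.2) (hk : k ≤ #E) :
    RobustlyLinked k H (X ∪ Y) := by
  intro S hS
  by_cases hXS : X ⊆ S
  · have : (X ∪ Y) \ S = Y \ S := by
      rw [union_sdiff_distrib, sdiff_eq_empty_iff_subset.2 hXS, empty_union]
    rw [this]
    exact hY S hS
  have hex : ∃ e ∈ E, ¬ (e.1 ∈ S ∨ e.2 ∈ S) := by
    by_contra! hall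
    have := hE S hXS
    rw [filter_true_of_mem hall] at this
    omega
  obtain ⟨e, he, heS⟩ := hex
  rw [not_or] at heS
  obtain ⟨he1, he2, hadj⟩ := hEX e he
  have hlX := hX S hS
  have hlY := hY S hS
  rw [union_sdiff_distrib]
  have m1 : e.1 ∈ X \ S := mem_sdiff.2 ⟨he1, heS.1⟩
  have m2 : e.2 ∈ Y \ S := mem_sdiff.2 ⟨he2, heS.2⟩
  have lift : ∀ {p : V → Prop} {Z : Finset V}, Z ⊆ X \ S ∪ Y \ S →
      (∃ x ∈ Z, ∃ y ∈ Z, p x ∧ ¬ p y ∧ H.Adj x y) →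
      ∃ x ∈ X \ S ∪ Y \ S, ∃ y ∈ X \ S ∪ Y \ S, p x ∧ ¬ p y ∧ H.Adj x y := by
    rintro p Z hZ ⟨x, hx, y, hy, h⟩
    exact ⟨x, hZ hx, y, hZ hy, h⟩
  rintro p ⟨x, hx, hpx⟩ ⟨y, hy, hpy⟩
  by_cases h1 : p e.1 <;> by_cases h2 : p e.2
  · rcases mem_union.1 hy with hy | hy
    · exact lift subset_union_left (hlX p ⟨_, m1, h1⟩ ⟨y, hy, hpy⟩)
    · exact lift subset_union_right (hlY p ⟨_, m2, h2⟩ ⟨y, hy, hpy⟩)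
  · exact ⟨_, mem_union_left _ m1, _, mem_union_right _ m2, h1, h2, hadj⟩
  · exact ⟨_, mem_union_right _ m2, _, mem_union_left _ m1, h2, h1, hadj.symm⟩
  · rcases mem_union.1 hx with hx | hx
    · exact lift subset_union_left (hlX p ⟨x, hx, hpx⟩ ⟨_, m1, h1⟩)
    · exact lift subset_union_right (hlY p ⟨x, hx, hpx⟩ ⟨_, m2, h2⟩)

/-- A highly connected graph has a large matching between any set and its complement. -/
theorem exists_crossing_matching [Fintype V] {t M : ℕ} {G : SimpleGraph V} (hG : RobustlyLinked t G univ)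
    {X : Finset V} (hX : M ≤ #X) (hXc : M ≤ #Xᶜ) (hM : 2 * M ≤ t + 1) :
    ∃ E : Finset (V × V), (∀ e ∈ E, e.1 ∈ X ∧ e.2 ∉ X ∧ G.Adj e.1 e.2) ∧
      Set.InjOn Prod.fst (E : Set (V × V)) ∧ Set.InjOn Prod.snd (E : Set (V × V)) ∧ M ≤ #E := by
  let P : Finset (Finset (V × V)) := {E | (∀ e ∈ E, e.1 ∈ X ∧ e.2 ∉ X ∧ G.Adj e.1 e.2) ∧
      Set.InjOn Prod.fst (E : Set (V × V)) ∧ Set.InjOn Prod.snd (E : Set (V × V))}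
  obtain ⟨E, hE, hmax⟩ := P.exists_max_image card ⟨∅, by simp [P]⟩
  simp only [P, mem_filter, mem_univ, true_and] at hE hmax
  refine ⟨E, hE.1, hE.2.1, hE.2.2, ?_⟩
  by_contra! hlt
  have c1 : #(E.image Prod.fst) ≤ #E := card_image_le
  have c2 : #(E.image Prod.snd) ≤ #E := card_image_le
  have c3 := card_union_le (E.image Prod.fst) (E.image Prod.snd)
  obtain ⟨x, hxX, hxE⟩ := exists_mem_notMem_of_card_lt_card (s := E.image Prod.fst) (t := X)
    (by omega)
  obtain ⟨y, hyX, hyE⟩ := exists_mem_notMem_of_card_lt_card (s := E.image Prod.snd) (t := Xᶜ)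
    (by omega)
  have hsndX : x ∉ E.image Prod.snd := fun h => by
    obtain ⟨e, he, rfl⟩ := mem_image.1 h
    exact (hE.1 e he).2.1 hxX
  have hfstX : y ∉ E.image Prod.fst := fun h => by
    obtain ⟨e, he, rfl⟩ := mem_image.1 h
    exact (mem_compl.1 hyX) (hE.1 e he).1
  -- A maximal matching with fewer than `M` arcs has at most `2M - 2 < t` ends; deleting them leaves
  -- a crossing edge that extends it.
  obtain ⟨a, ha, b, hb, haX, hbX, hab⟩ :=
    hG (E.image Prod.fst ∪ E.image Prod.snd) (by omega) (· ∈ X)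
      ⟨x, by simpa using ⟨by simpa using hxE, by simpa using hsndX⟩, hxX⟩
      ⟨y, by simpa using ⟨by simpa using hfstX, by simpa using hyE⟩, by simpa using hyX⟩
  simp only [mem_sdiff, mem_univ, true_and, mem_union, not_or] at ha hb
  have hnew : (a, b) ∉ E := fun h => ha.1 (mem_image.2 ⟨_, h, rfl⟩)
  have := hmax (insert (a, b) E) ⟨?_, ?_, ?_⟩
  · rw [card_insert_of_notMem hnew] at this
    omega
  · intro e he
    rcases mem_insert.1 he with rfl | he
    · exact ⟨haX, hbX, hab⟩
    · exact hE.1 e he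
  · rw [coe_insert, Set.injOn_insert (by simpa using hnew)]
    refine ⟨hE.2.1, ?_⟩
    rw [← coe_image]
    exact_mod_cast ha.1
  · rw [coe_insert, Set.injOn_insert (by simpa using hnew)]
    refine ⟨hE.2.2, ?_⟩
    rw [← coe_image]
    exact_mod_cast hb.2

/-- The arcs from `v` to the vertices of `N`. -/
def starArcs (v : V) (N : Finset V) : Finset (V × V) := N.image fun w => (v, w)

theorem card_starArcs (v : V) (N : Finset V) : #(starArcs v N) = #N :=
  card_image_of_injective _ fun _ _ h => (Prod.ext_iff.1 h).2

theorem mem_starArcs {v : V} {N : Finset V} {e : V × V} :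
    e ∈ starArcs v N ↔ e.1 = v ∧ e.2 ∈ N := by
  simp only [starArcs, mem_image]
  constructor
  · rintro ⟨w, hw, rfl⟩
    exact ⟨rfl, hw⟩
  · rintro ⟨h1, h2⟩
    exact ⟨e.2, h2, Prod.ext h1.symm rfl⟩

theorem injOn_snd_starArcs (v : V) (N : Finset V) :
    Set.InjOn Prod.snd (starArcs v N : Set (V × V)) := fun e he e' he' h => by
  have h1 := (mem_starArcs.1 (mem_coe.1 he)).1
  have h2 := (mem_starArcs.1 (mem_coe.1 he')).1
  exact Prod.ext (h1.trans h2.symm) h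

end Linked

/-! ### Dense graphs: Mader's theorem and half-bichromatic colourings -/

section Subsets

variable {V : Type*}

/-- Ordered pairs of vertices of `U` that are adjacent in `H`. -/
noncomputable def innerArcs (H : SimpleGraph V) (U : Finset V) : Finset (V × V) :=
  {e ∈ U ×ˢ U | H.Adj e.1 e.2}

theorem mem_innerArcs {H : SimpleGraph V} {U : Finset V} {e : V × V} :
    e ∈ innerArcs H U ↔ (e.1 ∈ U ∧ e.2 ∈ U) ∧ H.Adj e.1 e.2 := by
  simp [innerArcs]

variable [DecidableEq V]

theorem card_innerArcs (H : SimpleGraph V) (U : Finset V) :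
    #(innerArcs H U) = ∑ v ∈ U, #{w ∈ U | H.Adj v w} := by
  rw [card_eq_sum_card_fiberwise (f := Prod.fst) (t := U)
    (fun e he => (mem_innerArcs.1 he).1.1)]
  refine sum_congr rfl fun v hv => ?_
  refine card_nbij' Prod.snd (fun w => (v, w)) ?_ ?_ ?_ ?_
  · intro e he
    simp only [coe_filter, Set.mem_ofPred_eq, mem_innerArcs] at he ⊢
    exact ⟨he.1.1.2, he.2 ▸ he.1.2⟩
  · intro w hw
    simp only [coe_filter, Set.mem_ofPred_eq, mem_innerArcs] at hw ⊢
    exact ⟨⟨⟨hv, hw.1⟩, hw.2⟩, trivial⟩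
  · intro e he
    simp only [coe_filter, Set.mem_ofPred_eq] at he
    exact Prod.ext he.2.symm rfl
  · intro w _
    rfl

theorem card_innerArcs_erase (H : SimpleGraph V) {U : Finset V} {v : V} :
    #(innerArcs H U) ≤ #(innerArcs H (U.erase v)) + 2 * #{w ∈ U | H.Adj v w} := by
  have hsub : innerArcs H U ⊆ innerArcs H (U.erase v) ∪
      (({w ∈ U | H.Adj v w}.image fun w => (v, w)) ∪
        ({w ∈ U | H.Adj v w}.image fun w => (w, v))) := by
    rintro ⟨a, b⟩ he
    simp only [mem_innerArcs] at he
    simp only [mem_union, mem_innerArcs, mem_erase, mem_image, mem_filter, Prod.mk.injEq]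
    by_cases ha : a = v
    · subst ha
      exact .inr (.inl ⟨b, ⟨he.1.2, he.2⟩, rfl, rfl⟩)
    by_cases hb : b = v
    · subst hb
      exact .inr (.inr ⟨a, ⟨he.1.1, he.2.symm⟩, rfl, rfl⟩)
    exact .inl ⟨⟨⟨ha, he.1.1⟩, hb, he.1.2⟩, he.2⟩
  have h1 := card_le_card hsub
  have h2 := card_union_le (innerArcs H (U.erase v))
      (({w ∈ U | H.Adj v w}.image fun w => (v, w)) ∪
        ({w ∈ U | H.Adj v w}.image fun w => (w, v)))
  have h3 := card_union_le ({w ∈ U | H.Adj v w}.image fun w => (v, w))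
        ({w ∈ U | H.Adj v w}.image fun w => (w, v))
  have h4 : #({w ∈ U | H.Adj v w}.image fun w => (v, w)) ≤ _ := card_image_le
  have h5 : #({w ∈ U | H.Adj v w}.image fun w => (w, v)) ≤ _ := card_image_le
  omega

/-- Mader's theorem: a graph with many edges has a highly connected subgraph, here with control on
its order. -/
theorem exists_robustlyLinked_of_card_innerArcs {k γ : ℕ} (hk : 1 ≤ k) (hγ : 2 * k ≤ γ)
    (H : SimpleGraph V) (U : Finset V) (hU : 2 * k ≤ #U)
    (he : 2 * γ * #U < #(innerArcs H U) + 2 * γ * (k - 1)) :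
    ∃ W ⊆ U, γ < #W ∧ RobustlyLinked k H W := by
  induction hn : #U using Nat.strong_induction_on generalizing U with
  | _ n ih =>
  subst hn
  obtain ⟨s, rfl⟩ : ∃ s, k = s + 1 := ⟨k - 1, by omega⟩
  simp only [Nat.add_sub_cancel] at he ih
  have hbig : 2 * (s + 1) < #U := by
    refine lt_of_le_of_ne hU fun h => ?_
    have hle : #(innerArcs H U) ≤ #U * #U := by
      rw [← card_product]
      exact card_filter_le _ _
    rw [← h] at he hle
    nlinarith
  by_cases hdeg : ∃ v ∈ U, #{w ∈ U | H.Adj v w} ≤ γ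
  · obtain ⟨v, hv, hvγ⟩ := hdeg
    have h1 := card_innerArcs_erase H (U := U) (v := v)
    have h2 := card_erase_add_one hv
    obtain ⟨W, hW, h⟩ := ih _ (by omega) (U.erase v) (by omega) (by nlinarith) rfl
    exact ⟨W, hW.trans (erase_subset _ _), h⟩
  push Not at hdeg
  have hsize : ∀ X ⊆ U, ∀ v ∈ X, (∀ w ∈ U, H.Adj v w → w ∈ X) → γ < #X := by
    intro X hX v hv hX'
    refine (hdeg v (hX hv)).trans_le (card_le_card fun w hw => ?_)
    exact hX' w (mem_filter.1 hw).1 (mem_filter.1 hw).2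
  by_cases hrob : RobustlyLinked (s + 1) H U
  · obtain ⟨v, hv⟩ : U.Nonempty := card_pos.1 (by omega)
    exact ⟨U, Subset.rfl, hsize U Subset.rfl v hv fun w hw _ => hw, hrob⟩
  simp only [RobustlyLinked, Linked, not_forall] at hrob
  obtain ⟨S, hS, p, ⟨x, hx, hpx⟩, ⟨y, hy, hpy⟩, hno⟩ := hrob
  push Not at hno
  rw [mem_sdiff] at hx hy
  have hno' : ∀ a ∈ U, ∀ b ∈ U, H.Adj a b → a ∉ S → b ∉ S → (p a ↔ p b) := by
    intro a ha b hb hab haS hbS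
    by_contra hne
    by_cases h1 : p a
    · exact hno a (mem_sdiff.2 ⟨ha, haS⟩) b (mem_sdiff.2 ⟨hb, hbS⟩) h1 (by tauto) hab
    · exact hno b (mem_sdiff.2 ⟨hb, hbS⟩) a (mem_sdiff.2 ⟨ha, haS⟩) (by tauto) h1 hab.symm
  let A := {v ∈ U | v ∈ S ∨ p v}
  let B := {v ∈ U | v ∈ S ∨ ¬ p v}
  have hAB : A ∪ B = U := by
    ext v; simp only [A, B, mem_union, mem_filter]; tauto
  have hAiB : A ∩ B ⊆ S := by
    intro v; simp only [A, B, mem_inter, mem_filter]; tauto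
  have hAU : A ⊆ U := filter_subset _ _
  have hBU : B ⊆ U := filter_subset _ _
  have hcard := card_union_add_card_inter A B
  have hint := card_le_card hAiB
  rw [hAB] at hcard
  have hA : γ < #A := hsize A hAU x (mem_filter.2 ⟨hx.1, .inr hpx⟩) fun w hw hxw => by
    refine mem_filter.2 ⟨hw, ?_⟩
    by_contra! h
    exact h.2 ((hno' x hx.1 w hw hxw hx.2 h.1).1 hpx)
  have hB : γ < #B := hsize B hBU y (mem_filter.2 ⟨hy.1, .inr hpy⟩) fun w hw hyw => by
    refine mem_filter.2 ⟨hw, ?_⟩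
    by_contra! h
    exact hpy ((hno' y hy.1 w hw hyw hy.2 h.1).2 h.2)
  have hAlt : #A < #U := card_lt_card ⟨hAU, fun h => by
    have := h hy.1
    simp only [A, mem_filter] at this
    tauto⟩
  have hBlt : #B < #U := card_lt_card ⟨hBU, fun h => by
    have := h hx.1
    simp only [B, mem_filter] at this
    tauto⟩
  have harcs : #(innerArcs H U) ≤ #(innerArcs H A) + #(innerArcs H B) := by
    refine (card_le_card (t := innerArcs H A ∪ innerArcs H B) ?_).trans (card_union_le _ _)
    rintro ⟨a, b⟩ hab
    simp only [mem_union, mem_innerArcs, A, B, mem_filter] at hab ⊢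
    have := hno' a hab.1.1 b hab.1.2 hab.2
    tauto
  -- Since `#A + #B ≤ #U + s`, the correction term `2γs` lets one of the two sides inherit the
  -- density hypothesis.
  by_cases hcase : 2 * γ * #A < #(innerArcs H A) + 2 * γ * s
  · obtain ⟨W, hW, h⟩ := ih _ hAlt A (by omega) hcase rfl
    exact ⟨W, hW.trans hAU, h⟩
  · obtain ⟨W, hW, h⟩ := ih _ hBlt B (by omega) (by
      have : #A + #B ≤ #U + s := by omega
      have := Nat.mul_le_mul_left (2 * γ) this
      rw [mul_add, mul_add] at this
      omega) rfl
    exact ⟨W, hW.trans hBU, h⟩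

/-- Some colouring makes at least half of a family of arcs bichromatic. -/
theorem exists_half_bichromatic [Fintype V] (E : Finset (V × V)) (hE : ∀ e ∈ E, e.1 ≠ e.2) :
    ∃ σ : V → Bool, #E ≤ 2 * #{e ∈ E | σ e.1 ≠ σ e.2} := by
  by_contra! hlt
  have hsum : ∑ σ : V → Bool, 2 * #{e ∈ E | σ e.1 ≠ σ e.2} = ∑ _σ : V → Bool, #E := by
    have hpair : ∀ e ∈ E, 2 * #{σ : V → Bool | σ e.1 ≠ σ e.2} = Fintype.card (V → Bool) := by
      intro e he
      -- Recolouring one end of `e` pairs the two kinds of colouring.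
      have hflip : #{σ : V → Bool | σ e.1 ≠ σ e.2} = #{σ : V → Bool | ¬ σ e.1 ≠ σ e.2} := by
        have hne := (hE e he).symm
        refine card_nbij' (fun σ => Function.update σ e.1 (!σ e.1))
          (fun σ => Function.update σ e.1 (!σ e.1)) ?_ ?_ ?_ ?_
        · intro σ hσ
          simp only [coe_filter, mem_univ, true_and, Set.mem_ofPred_eq, Function.update_self,
            Function.update_of_ne hne] at hσ ⊢
          revert hσ; cases σ e.1 <;> cases σ e.2 <;> simp
        · intro σ hσ
          simp only [coe_filter, mem_univ, true_and, Set.mem_ofPred_eq, Function.update_self,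
            Function.update_of_ne hne] at hσ ⊢
          revert hσ; cases σ e.1 <;> cases σ e.2 <;> simp
        · intro σ _; simp
        · intro σ _; simp
      have := card_filter_add_card_filter_not (s := (univ : Finset (V → Bool)))
        (fun σ => σ e.1 ≠ σ e.2)
      rw [card_univ] at this
      omega
    simp only [← mul_sum, card_filter]
    rw [sum_comm]
    simp only [← card_filter]
    rw [mul_sum, sum_congr rfl hpair]
    simp [mul_comm]
  exact (sum_lt_sum_of_nonempty univ_nonempty fun σ _ => hlt σ).ne hsum

/-- Half of the at least `(4γ + 1) #R` ordered arcs can be made bichromatic, which is more than the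
`2γ #R` that Mader's theorem needs. -/
theorem exists_robustlyLinked_cutGraph [Fintype V] {k γ : ℕ} (hk : 1 ≤ k) (hγ : 2 * k ≤ γ)
    (G : SimpleGraph V) {R : Finset V} (hR : R.Nonempty)
    (hdeg : ∀ v ∈ R, 4 * γ + 1 ≤ #{w ∈ R | G.Adj v w}) :
    ∃ σ : V → Bool, ∃ W ⊆ R, γ < #W ∧ RobustlyLinked k (cutGraph G σ) W := by
  obtain ⟨σ, hσ⟩ := exists_half_bichromatic (innerArcs G R) fun e he =>
    (mem_innerArcs.1 he).2.ne
  refine ⟨σ, exists_robustlyLinked_of_card_innerArcs hk hγ _ R ?_ ?_⟩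
  · obtain ⟨v, hv⟩ := hR
    have := (hdeg v hv).trans (card_le_card (filter_subset _ _))
    omega
  · have h1 : #R * (4 * γ + 1) ≤ #(innerArcs G R) := by
      rw [card_innerArcs, ← smul_eq_mul]
      exact card_nsmul_le_sum _ _ _ hdeg
    have h2 : innerArcs (cutGraph G σ) R = {e ∈ innerArcs G R | σ e.1 ≠ σ e.2} := by
      ext e
      simp only [mem_innerArcs, mem_filter, cutGraph]
      tauto
    rw [h2]
    have := hR.card_pos
    nlinarith

end Subsets

/-! ### Separations of unions of classes -/

section Classes

variable {V : Type*} [Fintype V] [DecidableEq V]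

/-- The class of the vertices with label `i`. -/
def fiber (π : V → V) (i : V) : Finset V := {v | π v = i}

/-- The union of the classes with label in `J`. -/
def classUnion (π : V → V) (J : Finset V) : Finset V := {v | π v ∈ J}

theorem mem_fiber {π : V → V} {i v : V} : v ∈ fiber π i ↔ π v = i := by simp [fiber]

theorem mem_classUnion {π : V → V} {J : Finset V} {v : V} : v ∈ classUnion π J ↔ π v ∈ J := by
  simp [classUnion]

theorem fiber_subset_classUnion {π : V → V} {J : Finset V} {i : V} (hi : i ∈ J) :
    fiber π i ⊆ classUnion π J := fun _ hv => mem_classUnion.2 (mem_fiber.1 hv ▸ hi)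

/-- The labels in `J` of the classes with a vertex outside `S` that satisfies `p`. -/
noncomputable def sideLabels (π : V → V) (J S : Finset V) (p : V → Prop) : Finset V :=
  {i ∈ J | ∃ x ∈ fiber π i \ S, p x}

theorem mem_sideLabels {π : V → V} {J S : Finset V} {p : V → Prop} {i : V} :
    i ∈ sideLabels π J S p ↔ i ∈ J ∧ ∃ x ∈ fiber π i \ S, p x := by
  simp [sideLabels]

variable {k : ℕ} {H : SimpleGraph V} {π : V → V} {E : V → Finset (V × V)}

/-- If a set of fewer than `k` vertices disconnects a union of classes, then the classes on one side
send all but `k - 1` of their arcs to classes on the same side. -/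
theorem card_arcs_same_side {J S : Finset V} {p : V → Prop} (hS : #S < k)
    (hrob : ∀ i, RobustlyLinked k H (fiber π i))
    (hE : ∀ i, ∀ e ∈ E i, π e.1 = i ∧ H.Adj e.1 e.2) (hst : ∀ i, Sturdy (fiber π i) (E i))
    (hno : ∀ x ∈ classUnion π J \ S, ∀ y ∈ classUnion π J \ S, p x → ¬ p y → ¬ H.Adj x y)
    {i : V} (hi : i ∈ sideLabels π J S p) :
    #{e ∈ E i | π e.2 ∈ J} ≤
      #{e ∈ E i | π e.2 ∈ sideLabels π J S p} + (k - 1) := by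
  rw [mem_sideLabels] at hi
  obtain ⟨hiJ, x, hx, hpx⟩ := hi
  have hnot : ¬ fiber π i ⊆ S := fun h => (mem_sdiff.1 hx).2 (h (mem_sdiff.1 hx).1)
  have hsub : {e ∈ E i | π e.2 ∈ J} ⊆
      {e ∈ E i | π e.2 ∈ sideLabels π J S p} ∪
        {e ∈ E i | e.1 ∈ S ∨ e.2 ∈ S} := by
    intro e he
    rw [mem_filter] at he
    obtain ⟨he, heJ⟩ := he
    rw [mem_union, mem_filter, mem_filter]
    by_cases heS : e.1 ∈ S ∨ e.2 ∈ S
    · exact .inr ⟨he, heS⟩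
    rw [not_or] at heS
    refine .inl ⟨he, mem_sideLabels.2 ⟨heJ, e.2, mem_sdiff.2 ⟨mem_fiber.2 rfl, heS.2⟩, ?_⟩⟩
    obtain ⟨h1, hadj⟩ := hE i e he
    by_contra hp2
    -- The class `i` is still linked outside `S` and has a vertex satisfying `p`, so all its
    -- remaining vertices do.
    have hp1 : p e.1 := by
      by_contra hp1
      obtain ⟨a, ha, b, hb, hpa, hpb, hab⟩ := hrob i S hS p ⟨x, hx, hpx⟩
        ⟨e.1, mem_sdiff.2 ⟨mem_fiber.2 h1, heS.1⟩, hp1⟩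
      exact hno a (sdiff_subset_sdiff (fiber_subset_classUnion hiJ) Subset.rfl ha) b
        (sdiff_subset_sdiff (fiber_subset_classUnion hiJ) Subset.rfl hb) hpa hpb hab
    exact hno e.1 (mem_sdiff.2 ⟨mem_classUnion.2 (h1 ▸ hiJ), heS.1⟩) e.2
      (mem_sdiff.2 ⟨mem_classUnion.2 heJ, heS.2⟩) hp1 hp2 hadj
  have h1 := card_le_card hsub
  have h2 := card_union_le
    {e ∈ E i | π e.2 ∈ sideLabels π J S p}
    {e ∈ E i | e.1 ∈ S ∨ e.2 ∈ S}
  have h3 := hst i S hnot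
  omega

/-- If every class sends enough arcs to other classes, then some union of classes is robustly
linked: as long as it is not, pass to the side with fewer classes of a separation. -/
theorem exists_robustlyLinked_classUnion
    (hrob : ∀ i, RobustlyLinked k H (fiber π i))
    (hE : ∀ i, ∀ e ∈ E i, π e.1 = i ∧ H.Adj e.1 e.2) (hst : ∀ i, Sturdy (fiber π i) (E i))
    (d : V → ℕ) (J : Finset V) (hJ : J.Nonempty)
    (hd : ∀ i ∈ J, d i + (k - 1) * Nat.log 2 #J ≤ #{e ∈ E i | π e.2 ∈ J}) :
    ∃ J' ⊆ J, J'.Nonempty ∧ (∀ i ∈ J', d i ≤ #{e ∈ E i | π e.2 ∈ J'}) ∧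
      RobustlyLinked k H (classUnion π J') := by
  induction hn : #J using Nat.strong_induction_on generalizing J with
  | _ n ih =>
  subst hn
  by_cases hJr : RobustlyLinked k H (classUnion π J)
  · exact ⟨J, Subset.rfl, hJ, fun i hi => (Nat.le_add_right _ _).trans (hd i hi), hJr⟩
  have step : ∀ (S : Finset V) (p : V → Prop), #S < k →
      (∃ x ∈ classUnion π J \ S, p x) →
      (∀ x ∈ classUnion π J \ S, ∀ y ∈ classUnion π J \ S, p x → ¬ p y → ¬ H.Adj x y) →
      2 * #(sideLabels π J S p) ≤ #J →
      ∃ J' ⊆ J, J'.Nonempty ∧ (∀ i ∈ J', d i ≤ #{e ∈ E i | π e.2 ∈ J'}) ∧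
        RobustlyLinked k H (classUnion π J') := by
    rintro S p hS ⟨x, hx, hpx⟩ hno hhalf
    rw [mem_sdiff, mem_classUnion] at hx
    have hne : (sideLabels π J S p).Nonempty :=
      ⟨π x, mem_sideLabels.2 ⟨hx.1, x, mem_sdiff.2 ⟨mem_fiber.2 rfl, hx.2⟩, hpx⟩⟩
    have hpos := hne.card_pos
    obtain ⟨J', hJ', h⟩ := ih _ (by omega) (sideLabels π J S p) hne
      (fun i hi => by
        have h1 := card_arcs_same_side hS hrob hE hst hno hi
        have h2 := hd i (mem_sideLabels.1 hi).1
        -- Halving the number of classes frees one logarithmic unit, which pays for the `k - 1` lost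
        -- arcs.
        have h3 : Nat.log 2 #(sideLabels π J S p) + 1
            ≤ Nat.log 2 #J := by
          rw [← Nat.log_mul_base one_lt_two hpos.ne']
          exact Nat.log_mono_right (by omega)
        have h4 := Nat.mul_le_mul_left (k - 1) h3
        rw [mul_add] at h4
        omega) rfl
    exact ⟨J', hJ'.trans (filter_subset _ _), h⟩
  simp only [RobustlyLinked, Linked, not_forall] at hJr
  obtain ⟨S, hS, p, hx, hy, hno⟩ := hJr
  push Not at hno
  by_cases hhalf : 2 * #(sideLabels π J S p) ≤ #J
  · exact step S p hS hx hno hhalf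
  · refine step S (fun v => ¬ p v) hS hy
      (fun a ha b hb hpa hpb hab => hno b hb a ha (not_not.1 hpb) hpa hab.symm) ?_
    -- No class lies on both sides, as `S` cannot separate it; hence one side has at most half of
    -- the classes.
    have hdis : Disjoint (sideLabels π J S p)
        (sideLabels π J S fun v => ¬ p v) := by
      rw [disjoint_left]
      intro i hi hi'
      rw [mem_sideLabels] at hi hi'
      obtain ⟨a, ha, b, hb, hpa, hpb, hab⟩ := hrob i S hS p hi.2 hi'.2
      exact hno a (sdiff_subset_sdiff (fiber_subset_classUnion hi.1) Subset.rfl ha) b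
        (sdiff_subset_sdiff (fiber_subset_classUnion hi.1) Subset.rfl hb) hpa hpb hab
    have h1 := card_union_of_disjoint hdis
    have h2 := card_le_card (union_subset (fun i hi => (mem_sideLabels.1 hi).1)
      (fun i hi => (mem_sideLabels.1 hi).1) :
      sideLabels π J S p ∪ sideLabels π J S (fun v => ¬ p v) ⊆ J)
    omega

end Classes

/-! ### Random flips and exponential moments -/

section Flips

/-- With `y` the base, `y^a + y^b ≤ 1 + y^(a+b)`. Bernoulli's inequality with exponent `(a+b)/W ≤ 1`
bounds this by `2 - (3/4)(a+b)/W`, whence the rate `3/8`. -/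
theorem pow_add_pow_le_exp {W a b : ℕ} (hW : 0 < W) (hab : a + b ≤ W) :
    ((1 / 4 : ℝ) ^ (1 / W : ℝ)) ^ a + ((1 / 4 : ℝ) ^ (1 / W : ℝ)) ^ b ≤
      2 * Real.exp (-(3 / 8 / W) * (a + b : ℕ)) := by
  have hW' : (0 : ℝ) < W := by exact_mod_cast hW
  set y : ℝ := (1 / 4 : ℝ) ^ (1 / W : ℝ) with hy
  have hy0 : 0 ≤ y := by positivity
  have hy1 : y ≤ 1 := Real.rpow_le_one (by norm_num) (by norm_num) (by positivity)
  have h1 : y ^ a + y ^ b ≤ 1 + y ^ (a + b) := by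
    have ha : y ^ a ≤ 1 := pow_le_one₀ hy0 hy1
    have hb : y ^ b ≤ 1 := pow_le_one₀ hy0 hy1
    rw [pow_add]
    nlinarith
  have h2 : y ^ (a + b) ≤ 1 - 3 / 4 * ((a + b : ℕ) / W) := by
    have h := _root_.rpow_one_add_le_one_add_mul_self (s := -(3 / 4)) (p := (a + b : ℕ) / W)
      (by norm_num) (by positivity) ((div_le_one hW').2 (by exact_mod_cast hab))
    have he : y ^ (a + b) = (1 + -(3 / 4) : ℝ) ^ (((a + b : ℕ) : ℝ) / W) := by
      rw [hy, ← Real.rpow_natCast, ← Real.rpow_mul (by norm_num)]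
      norm_num
      ring_nf
    rw [he]
    linarith
  have h3 := Real.add_one_le_exp (-(3 / 8 / W) * (a + b : ℕ) : ℝ)
  have h4 : (3 / 8 / W) * ((a + b : ℕ) : ℝ) = 3 / 8 * ((a + b : ℕ) / W) := by ring
  rw [neg_mul, h4] at h3 ⊢
  linarith

/-- The exponential moment of the number of satisfied constraints `b e + τ i + τ (g e) = 1` for a
uniformly random `τ`. -/
theorem sum_pow_card_xor_le {ι α : Type*} [Fintype ι] [DecidableEq ι] (E : Finset α) (g : α → ι)
    (b : α → Bool) (i : ι) (hg : ∀ e ∈ E, g e ≠ i) {W : ℕ} (hW : 0 < W)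
    (hw : ∀ j, #{e ∈ E | g e = j} ≤ W) :
    ∑ τ : ι → Bool, ((1 / 4 : ℝ) ^ (1 / W : ℝ)) ^ #{e ∈ E | (b e ^^ τ i) ≠ τ (g e)} ≤
      2 ^ Fintype.card ι * Real.exp (-(3 / 8 / W) * #E) := by
  set y : ℝ := (1 / 4 : ℝ) ^ (1 / W : ℝ) with hy
  have hy0 : 0 ≤ y := by positivity
  -- Conditioning on `τ i = β` makes the moment a product over coordinates; the factor at `i` is the
  -- indicator of that event.
  let h : Bool → ι → Bool → ℝ := fun β j t =>
    if j = i then (if t = β then 1 else 0)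
    else ∏ e ∈ E with g e = j, if (b e ^^ β) ≠ t then y else 1
  have hh0 : ∀ β j t, 0 ≤ h β j t := by
    intro β j t
    simp only [h]
    split_ifs
    · exact zero_le_one
    · exact le_rfl
    · exact prod_nonneg fun e _ => by split_ifs <;> positivity
  have hterm : ∀ τ : ι → Bool, y ^ #{e ∈ E | (b e ^^ τ i) ≠ τ (g e)} ≤
      ∑ β, ∏ j, h β j (τ j) := by
    intro τ
    refine le_trans (le_of_eq ?_) (single_le_sum (f := fun β => ∏ j, h β j (τ j))
      (fun β _ => prod_nonneg fun j _ => hh0 _ _ _) (mem_univ (τ i)))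
    have hp : y ^ #{e ∈ E | (b e ^^ τ i) ≠ τ (g e)} =
        ∏ e ∈ E, if (b e ^^ τ i) ≠ τ (g e) then y else 1 := by
      rw [prod_ite, prod_const, prod_const_one, mul_one]
    rw [hp, ← prod_fiberwise E g]
    refine prod_congr rfl fun j _ => ?_
    by_cases hj : j = i
    · subst hj
      simp only [h, if_true]
      rw [filter_false_of_mem hg, prod_empty]
    · simp only [h, if_neg hj]
      refine prod_congr rfl fun e he => ?_
      rw [(mem_filter.1 he).2]
  have hfactor : ∀ β j, ∑ t, h β j t ≤
      (if j = i then 1 / 2 else 1) * (2 * Real.exp (-(3 / 8 / W) * #{e ∈ E | g e = j})) := by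
    intro β j
    by_cases hj : j = i
    · subst hj
      simp only [h, if_true]
      rw [filter_false_of_mem hg]
      simp
    · simp only [h, if_neg hj, one_mul, Fintype.sum_bool]
      set F := {e ∈ E | g e = j} with hF
      have hp : ∀ t : Bool, ∏ e ∈ F, (if (b e ^^ β) ≠ t then y else 1) =
          y ^ #{e ∈ F | (b e ^^ β) ≠ t} := by
        intro t
        rw [prod_ite, prod_const, prod_const_one, mul_one]
      rw [hp, hp]
      have hc : #{e ∈ F | (b e ^^ β) ≠ true} + #{e ∈ F | (b e ^^ β) ≠ false} = #F := by
        rw [← card_filter_add_card_filter_not (s := F) (fun e => (b e ^^ β) ≠ true)]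
        congr 2
        ext e
        cases (b e ^^ β) <;> simp
      have := pow_add_pow_le_exp hW (hc.trans_le (hw j))
      rwa [hc] at this
  calc ∑ τ : ι → Bool, y ^ #{e ∈ E | (b e ^^ τ i) ≠ τ (g e)}
      ≤ ∑ τ : ι → Bool, ∑ β, ∏ j, h β j (τ j) := sum_le_sum fun τ _ => hterm τ
    _ = ∑ β, ∏ j, ∑ t, h β j t := by
        rw [sum_comm]
        refine sum_congr rfl fun β _ => ?_
        rw [prod_univ_sum, Fintype.piFinset_univ]
    _ ≤ ∑ _β : Bool, ∏ j, ((if j = i then 1 / 2 else 1) *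
          (2 * Real.exp (-(3 / 8 / W) * #{e ∈ E | g e = j}))) :=
        sum_le_sum fun β _ => prod_le_prod (fun j _ => sum_nonneg fun t _ => hh0 _ _ _)
          fun j _ => hfactor β j
    _ = 2 ^ Fintype.card ι * Real.exp (-(3 / 8 / W) * #E) := by
        have hs : ∑ j, -(3 / 8 / W) * (#{e ∈ E | g e = j} : ℝ) = -(3 / 8 / W) * #E := by
          rw [← mul_sum, ← Nat.cast_sum, ← card_eq_sum_card_fiberwise (fun e _ => mem_univ (g e))]
        rw [prod_mul_distrib, prod_mul_distrib, prod_ite_eq' univ i, ← Real.exp_sum, hs]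
        simp

/-- Flips of the classes of `π` for which every class keeps many bichromatic arcs. -/
theorem exists_flips {V : Type*} [Fintype V] [DecidableEq V] {W : ℕ} (hW : 0 < W) (σ : V → Bool)
    (π : V → V) (E : V → Finset (V × V)) (I : Finset V)
    (hE : ∀ i ∈ I, ∀ e ∈ E i, π e.1 = i ∧ π e.2 ≠ i)
    (hw : ∀ i ∈ I, ∀ j, #{e ∈ E i | π e.2 = j} ≤ W) (T : V → ℕ)
    (hT : ∀ i ∈ I, Real.log 4 * T i + W * Real.log (Fintype.card V) < 3 / 8 * #(E i)) :
    ∃ τ : V → Bool, ∀ i ∈ I,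
      T i ≤ #{e ∈ E i | (σ e.1 ^^ τ (π e.1)) ≠ (σ e.2 ^^ τ (π e.2))} := by
  by_contra! hlt
  have hW' : (0 : ℝ) < W := by exact_mod_cast hW
  set y : ℝ := (1 / 4 : ℝ) ^ (1 / W : ℝ) with hy
  have hy0 : 0 < y := by positivity
  have hy1 : y ≤ 1 := Real.rpow_le_one (by norm_num) (by norm_num) (by positivity)
  have hcount : ∀ i ∈ I, ∀ τ : V → Bool,
      #{e ∈ E i | (σ e.1 ^^ τ (π e.1)) ≠ (σ e.2 ^^ τ (π e.2))} =
        #{e ∈ E i | ((σ e.1 ^^ σ e.2) ^^ τ i) ≠ τ (π e.2)} := by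
    intro i hi τ
    congr 1
    refine filter_congr fun e he => ?_
    rw [(hE i hi e he).1]
    cases σ e.1 <;> cases σ e.2 <;> cases τ i <;> cases τ (π e.2) <;> simp
  have hpowT : ∀ i, y ^ T i = Real.exp (-(Real.log 4 * T i / W)) := by
    intro i
    rw [hy, ← Real.rpow_natCast, ← Real.rpow_mul (by norm_num),
      Real.rpow_def_of_pos (by norm_num), one_div, Real.log_inv]
    congr 1
    ring
  have hne : I.Nonempty := by
    obtain ⟨i, hi, -⟩ := hlt fun _ => true
    exact ⟨i, hi⟩
  have hV : (0 : ℝ) < Fintype.card V := by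
    exact_mod_cast hne.card_pos.trans_le (card_le_univ I)
  -- Markov's inequality and a union bound: a class missing its target contributes at least 1, while
  -- each class averages below `1 / Fintype.card V`.
  have hone : ∀ τ : V → Bool, (1 : ℝ) ≤
      ∑ i ∈ I, y ^ #{e ∈ E i | ((σ e.1 ^^ σ e.2) ^^ τ i) ≠ τ (π e.2)} / y ^ T i := by
    intro τ
    obtain ⟨i, hi, hiT⟩ := hlt τ
    rw [hcount i hi] at hiT
    refine le_trans ?_ (single_le_sum (f := fun i =>
      y ^ #{e ∈ E i | ((σ e.1 ^^ σ e.2) ^^ τ i) ≠ τ (π e.2)} / y ^ T i)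
      (fun j _ => by positivity) hi)
    rw [one_le_div (by positivity)]
    exact pow_le_pow_of_le_one hy0.le hy1 hiT.le
  have hterm : ∀ i ∈ I, ∑ τ : V → Bool,
      y ^ #{e ∈ E i | ((σ e.1 ^^ σ e.2) ^^ τ i) ≠ τ (π e.2)} / y ^ T i <
        2 ^ Fintype.card V / Fintype.card V := by
    intro i hi
    rw [← sum_div, div_lt_div_iff₀ (by positivity) hV]
    have h1 := sum_pow_card_xor_le (E i) (fun e => π e.2) (fun e => σ e.1 ^^ σ e.2) i
      (fun e he => (hE i hi e he).2) hW (hw i hi)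
    have h2 : Real.exp (-(3 / 8 / W) * #(E i)) * Fintype.card V < y ^ T i := by
      rw [hpowT, ← Real.exp_log hV, ← Real.exp_add, Real.exp_lt_exp]
      have := div_lt_div_of_pos_right (hT i hi) hW'
      have e1 : (Real.log 4 * T i + W * Real.log (Fintype.card V)) / W =
        Real.log 4 * T i / W + Real.log (Fintype.card V) := by field_simp
      have e2 : -(3 / 8 / W) * (#(E i) : ℝ) = -(3 / 8 * #(E i) / W) := by ring
      rw [e2]
      linarith
    calc _ ≤ 2 ^ Fintype.card V * Real.exp (-(3 / 8 / W) * #(E i)) * Fintype.card V := by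
          gcongr
      _ = 2 ^ Fintype.card V * (Real.exp (-(3 / 8 / W) * #(E i)) * Fintype.card V) := by ring
      _ < _ := by gcongr
  have htotal : (2 : ℝ) ^ Fintype.card V ≤ ∑ i ∈ I, ∑ τ : V → Bool,
      y ^ #{e ∈ E i | ((σ e.1 ^^ σ e.2) ^^ τ i) ≠ τ (π e.2)} / y ^ T i := by
    rw [sum_comm]
    refine le_trans (le_of_eq ?_) (sum_le_sum fun τ _ => hone τ)
    simp
  have h3 := htotal.trans_lt (sum_lt_sum_of_nonempty hne hterm)
  rw [sum_const, nsmul_eq_mul, ← mul_div_assoc, lt_div_iff₀ hV, mul_comm] at h3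
  have h4 : (#I : ℝ) ≤ Fintype.card V := by exact_mod_cast card_le_univ I
  have h5 : (0 : ℝ) < 2 ^ Fintype.card V := by positivity
  nlinarith

end Flips

/-! ### Optimal piece labellings and the two regimes -/

section Labellings

variable {V : Type*} [Fintype V] [DecidableEq V]

/-- Each class of `π` is robustly linked by its bichromatic edges, and is a single vertex or has at
least `L` vertices. -/
structure IsPieceLabelling (G : SimpleGraph V) (k L : ℕ) (π : V → V) (σ : V → Bool) : Prop where
  robust : ∀ i, RobustlyLinked k (cutGraph G σ) (fiber π i)
  large : ∀ i, #(fiber π i) ≤ 1 ∨ L ≤ #(fiber π i)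

/-- A piece labelling with as few classes as possible. -/
structure IsOptimalLabelling (G : SimpleGraph V) (k L : ℕ) (π : V → V) (σ : V → Bool) : Prop
    extends IsPieceLabelling G k L π σ where
  card_le : ∀ π' σ', IsPieceLabelling G k L π' σ' → #(univ.image π) ≤ #(univ.image π')

variable {G : SimpleGraph V} {k L t : ℕ} {π : V → V} {σ : V → Bool}

theorem exists_isOptimalLabelling (G : SimpleGraph V) (k L : ℕ) :
    ∃ π σ, IsOptimalLabelling G k L π σ := by
  have hid : IsPieceLabelling G k L id fun _ => true := by
    have h1 : ∀ i : V, #(fiber id i) ≤ 1 := fun i => by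
      have : fiber id i = {i} := by ext v; simp [mem_fiber]
      simp [this]
    exact ⟨fun i => .of_card_le_one (h1 i), fun i => .inl (h1 i)⟩
  obtain ⟨⟨π, σ⟩, h, hmin⟩ := exists_min_image
    ({q | IsPieceLabelling G k L q.1 q.2} : Finset ((V → V) × (V → Bool)))
    (fun q => #(univ.image q.1)) ⟨(id, fun _ => true), by simpa using hid⟩
  exact ⟨π, σ, (mem_filter.1 h).2, fun π' σ' h' => hmin (π', σ') (by simpa using h')⟩

theorem IsPieceLabelling.robust_flip (h : IsPieceLabelling G k L π σ) (τ : V → Bool) (i : V) :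
    RobustlyLinked k (cutGraph G fun v => σ v ^^ τ (π v)) (fiber π i) := by
  refine (h.robust i).congr fun x hx y hy hxy => ?_
  rw [mem_fiber] at hx hy
  simpa [hx, hy] using hxy

/-- Classes of an optimal labelling cannot be merged. -/
theorem IsOptimalLabelling.not_robustlyLinked_classUnion (h : IsOptimalLabelling G k L π σ)
    {σ' : V → Bool} (hσ' : ∀ i, RobustlyLinked k (cutGraph G σ') (fiber π i)) {J : Finset V}
    {a b : V} (ha : a ∈ J) (hb : b ∈ J) (hab : a ≠ b) (haπ : a ∈ univ.image π)
    (hbπ : b ∈ univ.image π) (hL : L ≤ #(classUnion π J)) :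
    ¬ RobustlyLinked k (cutGraph G σ') (classUnion π J) := by
  intro hJ
  -- Giving all of `J` the label `a` loses at least the label `b`, against minimality.
  let π' : V → V := fun v => if π v ∈ J then a else π v
  have hfa : fiber π' a = classUnion π J := by
    ext v
    simp only [mem_fiber, mem_classUnion, π']
    split_ifs with hv
    · simpa using hv
    · exact ⟨fun e => absurd (e ▸ ha) hv, fun h => absurd h hv⟩
  have hfib : ∀ i, i ≠ a → fiber π' i = fiber π i ∨ fiber π' i = ∅ := by
    intro i hi
    by_cases hiJ : i ∈ J
    · right
      rw [eq_empty_iff_forall_notMem]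
      intro v hv
      simp only [mem_fiber, π'] at hv
      split_ifs at hv with hvJ
      · exact hi hv.symm
      · exact hvJ (hv ▸ hiJ)
    · left
      ext v
      simp only [mem_fiber, π']
      split_ifs with hv
      · exact ⟨fun e => absurd e.symm hi, fun e => absurd (e ▸ hv) hiJ⟩
      · rfl
  have hpl : IsPieceLabelling G k L π' σ' := by
    refine ⟨fun i => ?_, fun i => ?_⟩
    · by_cases hi : i = a
      · rw [hi, hfa]; exact hJ
      · rcases hfib i hi with h' | h' <;> rw [h']
        · exact hσ' i
        · exact .of_card_le_one (by simp)
    · by_cases hi : i = a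
      · rw [hi, hfa]; exact .inr hL
      · rcases hfib i hi with h' | h' <;> rw [h']
        · exact h.large i
        · exact .inl (by simp)
  have hsub : univ.image π' ⊆ (univ.image π).erase b := by
    intro x hx
    obtain ⟨v, -, rfl⟩ := mem_image.1 hx
    simp only [π']
    split_ifs with hv
    · exact mem_erase.2 ⟨hab, haπ⟩
    · exact mem_erase.2 ⟨fun e => hv (e ▸ hb), mem_image_of_mem _ (mem_univ v)⟩
  have h1 := card_le_card hsub
  have h2 := card_erase_add_one hbπ
  have h3 := h.card_le π' σ' hpl
  omega

/-- There are few arcs in a sturdy family between two classes of an optimal labelling. -/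
theorem IsOptimalLabelling.card_arcs_lt (h : IsOptimalLabelling G k L π σ) (hk : 1 ≤ k)
    {i j : V} (hij : i ≠ j) {E : Finset (V × V)}
    (hE : ∀ e ∈ E, π e.1 = i ∧ π e.2 = j ∧ G.Adj e.1 e.2) (hst : Sturdy (fiber π i) E)
    (hL : L ≤ #(fiber π i) ∨ L ≤ #(fiber π j)) : #E + 1 < 2 * k := by
  by_contra! hcard
  obtain ⟨e₀, he₀⟩ : E.Nonempty := card_pos.1 (by omega)
  -- Each of the at least `2k - 1` arcs is bichromatic for exactly one `β`.
  have hβ : ∃ β : Bool, k ≤ #{e ∈ E | σ e.1 ≠ (σ e.2 ^^ β)} := by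
    by_contra! hlt
    have h1 := card_filter_add_card_filter_not (s := E) (fun e => σ e.1 ≠ σ e.2)
    have h2 := hlt false
    have h3 := hlt true
    have e2 : #{e ∈ E | σ e.1 ≠ (σ e.2 ^^ false)} = #{e ∈ E | σ e.1 ≠ σ e.2} := by simp
    have e3 : #{e ∈ E | σ e.1 ≠ (σ e.2 ^^ true)} = #{e ∈ E | ¬ σ e.1 ≠ σ e.2} := by
      congr 1
      refine filter_congr fun e _ => ?_
      cases σ e.1 <;> cases σ e.2 <;> simp
    omega
  obtain ⟨β, hβ⟩ := hβ
  let τ : V → Bool := fun l => if l = j then β else false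
  have hU : classUnion π {i, j} = fiber π i ∪ fiber π j := by
    ext v; simp [mem_classUnion, mem_fiber]
  refine h.not_robustlyLinked_classUnion (h.robust_flip τ) (J := {i, j}) (a := i) (b := j)
    (by simp) (by simp) hij (mem_image.2 ⟨_, mem_univ _, (hE e₀ he₀).1⟩)
    (mem_image.2 ⟨_, mem_univ _, (hE e₀ he₀).2.1⟩) ?_ ?_
  · rw [hU]
    rcases hL with hL | hL
    · exact hL.trans (card_le_card subset_union_left)
    · exact hL.trans (card_le_card subset_union_right)
  · rw [hU]
    refine (h.robust_flip τ i).union (h.robust_flip τ j) (hst.mono (filter_subset _ _)) ?_ hβ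
    intro e he
    obtain ⟨he, hne⟩ := mem_filter.1 he
    obtain ⟨h1, h2, h3⟩ := hE e he
    refine ⟨mem_fiber.2 h1, mem_fiber.2 h2, h3, ?_⟩
    simpa [τ, h1, h2, hij] using hne

/-- Deleting fewer than `t` neighbours would isolate `v` from some other vertex. -/
theorem KConnected.le_card_neighbors (hG : KConnected t G) (v : V) :
    t ≤ #{w | G.Adj v w} := by
  by_contra! hlt
  have hv : v ∉ ({w | G.Adj v w} : Finset V) := by simp
  obtain ⟨y, -, hy⟩ := exists_mem_notMem_of_card_lt_card
    (s := insert v ({w | G.Adj v w} : Finset V)) (t := univ) (by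
      rw [card_insert_of_notMem hv, card_univ]
      have := hG.1
      omega)
  rw [mem_insert, not_or] at hy
  obtain ⟨a, ha, b, hb, rfl, -, hab⟩ := hG.robustlyLinked _ hlt (· = v)
    ⟨v, mem_sdiff.2 ⟨mem_univ _, hv⟩, rfl⟩ ⟨y, mem_sdiff.2 ⟨mem_univ _, hy.2⟩, hy.1⟩
  exact (mem_sdiff.1 hb).2 (by simpa using hab)

theorem fiber_eq_singleton {v : V} (h : #(fiber π (π v)) ≤ 1) : fiber π (π v) = {v} :=
  eq_singleton_iff_unique_mem.2
    ⟨mem_fiber.2 rfl, fun _ hw => card_le_one.1 h _ hw _ (mem_fiber.2 rfl)⟩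

theorem sturdy_starArcs {v : V} (h : #(fiber π (π v)) ≤ 1) (N : Finset V) :
    Sturdy (fiber π (π v)) (starArcs v N) := by
  rw [fiber_eq_singleton h]
  exact .of_star (fun e he => (mem_starArcs.1 he).1) (injOn_snd_starArcs v N)

/-- A vertex forming a class by itself has few neighbours in each large class. -/
theorem IsOptimalLabelling.card_neighbors_lt (h : IsOptimalLabelling G k L π σ) (hk : 1 ≤ k)
    {v j : V} (hv : #(fiber π (π v)) ≤ 1) (hj : L ≤ #(fiber π j)) (hvj : π v ≠ j) :
    #{w ∈ fiber π j | G.Adj v w} + 1 < 2 * k := by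
  rw [← card_starArcs v]
  refine h.card_arcs_lt hk hvj (fun e he => ?_) (sturdy_starArcs hv _) (.inr hj)
  obtain ⟨h1, h2⟩ := mem_starArcs.1 he
  rw [mem_filter, mem_fiber] at h2
  exact ⟨h1 ▸ rfl, h2.1, h1 ▸ h2.2⟩

/-- Every class of an optimal labelling of a highly connected graph sends out many arcs. -/
theorem IsOptimalLabelling.exists_arcs (h : IsOptimalLabelling G k L π σ) (hG : KConnected t G)
    (hk : 1 ≤ k) (hL : 2 * L ≤ t + 1) (hkL : 2 * k + L ≤ t + 1) (hm : 1 < #(univ.image π))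
    {i : V} (hi : i ∈ univ.image π) :
    ∃ E : Finset (V × V), (∀ e ∈ E, π e.1 = i ∧ π e.2 ≠ i ∧ G.Adj e.1 e.2) ∧
      Sturdy (fiber π i) E ∧ Set.InjOn Prod.snd (E : Set (V × V)) ∧ L ≤ #E ∧
      (#(fiber π i) ≤ 1 → t ≤ #E) := by
  by_cases h1 : #(fiber π i) ≤ 1
  · obtain ⟨v, -, rfl⟩ := mem_image.1 hi
    have hN := hG.le_card_neighbors v
    refine ⟨starArcs v {w | G.Adj v w}, fun e he => ?_, sturdy_starArcs h1 _,
      injOn_snd_starArcs _ _, ?_, fun _ => ?_⟩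
    · obtain ⟨h2, h3⟩ := mem_starArcs.1 he
      rw [mem_filter] at h3
      refine ⟨h2 ▸ rfl, fun h4 => h3.2.ne ?_, h2 ▸ h3.2⟩
      have : e.2 ∈ fiber π (π v) := mem_fiber.2 h4
      rw [fiber_eq_singleton h1, mem_singleton] at this
      exact this.symm
    · rw [card_starArcs]; omega
    · rwa [card_starArcs]
  have hiL := (h.large i).resolve_left h1
  by_cases hc : L ≤ #(fiber π i)ᶜ
  · obtain ⟨E, hE, hi1, hi2, hLE⟩ := exists_crossing_matching hG.robustlyLinked hiL hc hL
    refine ⟨E, fun e he => ?_, .of_matching (fun e he => (hE e he).1) (fun e he => (hE e he).2.1)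
      hi1 hi2, hi2, hLE, fun h2 => absurd h2 h1⟩
    obtain ⟨h2, h3, h4⟩ := hE e he
    rw [mem_fiber] at h2 h3
    exact ⟨h2, h3, h4⟩
  -- With fewer than `L` vertices outside class `i`, another class is a singleton; it has at most
  -- `2k - 2` neighbours in class `i` and fewer than `L` outside, too few for degree `t`.
  exfalso
  obtain ⟨j, hj, hji⟩ := exists_mem_ne hm i
  obtain ⟨v, -, rfl⟩ := mem_image.1 hj
  have hsub : fiber π (π v) ⊆ (fiber π i)ᶜ := fun w hw => by
    rw [mem_compl, mem_fiber]
    rw [mem_fiber] at hw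
    exact hw ▸ hji
  have hv : #(fiber π (π v)) ≤ 1 := (h.large _).resolve_right fun h2 =>
    hc (h2.trans (card_le_card hsub))
  have hlt := h.card_neighbors_lt hk hv hiL hji
  have hN := hG.le_card_neighbors v
  have hsplit : ({w | G.Adj v w} : Finset V) ⊆ {w ∈ fiber π i | G.Adj v w} ∪ (fiber π i)ᶜ := by
    intro w hw
    simp only [mem_filter, mem_univ, true_and, mem_union, mem_compl] at hw ⊢
    tauto
  have h2 := (card_le_card hsplit).trans (card_union_le _ _)
  omega

theorem IsOptimalLabelling.hasSpanning (h : IsOptimalLabelling G k L π σ)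
    (hk : k + 1 ≤ Fintype.card V) (hm : #(univ.image π) ≤ 1) :
    HasSpanningBipartiteKConnected k G := by
  have hpos : 0 < Fintype.card V := by omega
  obtain ⟨v⟩ := Fintype.card_pos_iff.1 hpos
  refine hasSpanningBipartiteKConnected_of_cutGraph (σ := σ) hk ?_
  have : fiber π (π v) = univ := by
    ext w
    simp only [mem_fiber, mem_univ, iff_true]
    exact card_le_one.1 hm _ (mem_image_of_mem _ (mem_univ _)) _ (mem_image_of_mem _ (mem_univ _))
  exact this ▸ h.robust (π v)

/-- For `k = 1` a single arc already merges two classes. The constants of `f_le_log` serve only `k ≥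
2`. -/
theorem hasSpanningBipartiteKConnected_one (hG : KConnected t G) (ht : 2 ≤ t) :
    HasSpanningBipartiteKConnected 1 G := by
  obtain ⟨π, σ, h⟩ := exists_isOptimalLabelling G 1 1
  refine h.hasSpanning (by have := hG.1; omega) ?_
  by_contra! hm
  obtain ⟨i, hi⟩ := card_pos.1 (zero_lt_one.trans hm)
  obtain ⟨E, hE, hst, -, hcard, -⟩ := h.exists_arcs hG le_rfl (by omega) (by omega) hm hi
  obtain ⟨e, he⟩ := card_pos.1 (zero_lt_one.trans_le hcard)
  obtain ⟨h1, h2, h3⟩ := hE e he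
  have := h.card_arcs_lt le_rfl h2.symm (E := {e}) (fun e' he' => by
    rw [mem_singleton.1 he']
    exact ⟨h1, rfl, h3⟩) (hst.mono (by simpa using he))
    (.inl (card_pos.2 ⟨e.1, mem_fiber.2 h1⟩))
  simp at this

/-- The logarithmic regime. -/
theorem hasSpanningBipartiteKConnected_of_log (hG : KConnected t G) (hk : 1 ≤ k)
    (hL : 2 * L ≤ t + 1) (hkL : 2 * k + L ≤ t + 1)
    (hlarge : Real.log 4 * (1 + (k - 1) * Nat.log 2 (Fintype.card V) : ℕ) +
      (2 * k : ℕ) * Real.log (Fintype.card V) < 3 / 8 * L)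
    (hsmall : Real.log 4 * (L + (k - 1) * Nat.log 2 (Fintype.card V) : ℕ) +
      (2 * k : ℕ) * Real.log (Fintype.card V) < 3 / 8 * t) :
    HasSpanningBipartiteKConnected k G := by
  obtain ⟨π, σ, h⟩ := exists_isOptimalLabelling G k L
  refine h.hasSpanning (by have := hG.1; omega) ?_
  by_contra! hm
  have hL1 : 1 ≤ L := by
    rw [Nat.one_le_iff_ne_zero]
    rintro rfl
    have h1 : 0 ≤ Real.log 4 := Real.log_nonneg (by norm_num)
    have h2 : 0 ≤ Real.log (Fintype.card V) := Real.log_natCast_nonneg _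
    have : 0 ≤ Real.log 4 * (1 + (k - 1) * Nat.log 2 (Fintype.card V) : ℕ) +
      (2 * k : ℕ) * Real.log (Fintype.card V) := by positivity
    simp only [Nat.cast_zero, mul_zero] at hlarge
    linarith
  have hex : ∀ i, ∃ E : Finset (V × V), (∀ e ∈ E, π e.1 = i ∧ π e.2 ≠ i ∧ G.Adj e.1 e.2) ∧
      Sturdy (fiber π i) E ∧ Set.InjOn Prod.snd (E : Set (V × V)) ∧
      (i ∈ univ.image π → L ≤ #E ∧ (#(fiber π i) ≤ 1 → t ≤ #E)) := by
    intro i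
    by_cases hi : i ∈ univ.image π
    · obtain ⟨E, h1, h2, h3, h4⟩ := h.exists_arcs hG hk hL hkL hm hi
      exact ⟨E, h1, h2, h3, fun _ => h4⟩
    · exact ⟨∅, by simp, fun S _ => by simp, by simp, fun h => absurd h hi⟩
  choose E hE hst hinj hcard using hex
  -- One arc gives the final union a second class; a singleton needs `L` arcs, with distinct heads,
  -- for the union to have at least `L` vertices.
  let d : V → ℕ := fun i => if #(fiber π i) ≤ 1 then L else 1
  obtain ⟨τ, hτ⟩ := exists_flips (W := 2 * k) (by omega) σ π E (univ.image π)
    (fun i _ e he => ⟨(hE i e he).1, (hE i e he).2.1⟩)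
    (fun i _ j => by
      by_cases hij : i = j
      · subst hij
        rw [filter_false_of_mem fun e he => (hE i e he).2.1]
        simp
      by_cases hbig : L ≤ #(fiber π i) ∨ L ≤ #(fiber π j)
      · have := h.card_arcs_lt hk hij (E := {e ∈ E i | π e.2 = j}) (fun e he => by
          obtain ⟨he, hej⟩ := mem_filter.1 he
          exact ⟨(hE i e he).1, hej, (hE i e he).2.2⟩) ((hst i).mono (filter_subset _ _)) hbig
        omega
      · have hj : #(fiber π j) ≤ 1 := (h.large j).resolve_right fun h' => hbig (.inr h')
        have : #{e ∈ E i | π e.2 = j} ≤ #(fiber π j) :=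
          card_le_card_of_injOn Prod.snd
            (fun e he => mem_fiber.2 (mem_filter.1 (mem_coe.1 he)).2)
            ((hinj i).mono fun e he => (mem_filter.1 (mem_coe.1 he)).1)
        omega)
    (fun i => d i + (k - 1) * Nat.log 2 (Fintype.card V))
    (fun i hi => by
      obtain ⟨h1, h2⟩ := hcard i hi
      by_cases hone : #(fiber π i) ≤ 1
      · have : (t : ℝ) ≤ #(E i) := by exact_mod_cast h2 hone
        simp only [d, if_pos hone]
        linarith
      · have : (L : ℝ) ≤ #(E i) := by exact_mod_cast h1
        simp only [d, if_neg hone]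
        linarith)
  let E' : V → Finset (V × V) := fun i =>
    {e ∈ E i | (σ e.1 ^^ τ (π e.1)) ≠ (σ e.2 ^^ τ (π e.2))}
  have hE' : ∀ i, E' i ⊆ E i := fun i => filter_subset _ _
  obtain ⟨J, hJ, ⟨i, hiJ⟩, hd, hrob⟩ := exists_robustlyLinked_classUnion
    (H := cutGraph G fun v => σ v ^^ τ (π v)) (E := E') (π := π) (h.robust_flip τ)
    (fun i e he => ⟨(hE i e (hE' i he)).1, (hE i e (hE' i he)).2.2, (mem_filter.1 he).2⟩)
    (fun i => (hst i).mono (hE' i)) d (univ.image π) (card_pos.1 (by omega))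
    (fun i hi => by
      rw [filter_true_of_mem fun e _ => mem_image_of_mem π (mem_univ e.2)]
      refine le_trans (Nat.add_le_add_left (Nat.mul_le_mul_left _ ?_) _) (hτ i hi)
      exact Nat.log_mono_right (card_le_univ _))
  have hd1 : 1 ≤ d i := by
    simp only [d]
    split_ifs <;> omega
  obtain ⟨e, he⟩ := card_pos.1 (hd1.trans (hd i hiJ))
  obtain ⟨he, heJ⟩ := mem_filter.1 he
  refine h.not_robustlyLinked_classUnion (h.robust_flip τ) hiJ heJ (hE i e (hE' i he)).2.1.symm
    (hJ hiJ) (hJ heJ) ?_ hrob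
  by_cases hone : #(fiber π i) ≤ 1
  · have h1 : L ≤ #{e ∈ E' i | π e.2 ∈ J} := by
      simpa only [d, if_pos hone] using hd i hiJ
    exact h1.trans (card_le_card_of_injOn Prod.snd
      (fun e he => mem_classUnion.2 (mem_filter.1 (mem_coe.1 he)).2)
      ((hinj i).mono fun e he => hE' i (mem_filter.1 (mem_coe.1 he)).1))
  · exact ((h.large i).resolve_left hone).trans (card_le_card (fiber_subset_classUnion hiJ))

theorem card_labels_mul_le (π : V → V) {J : Finset V} (hJ : ∀ j ∈ J, L ≤ #(fiber π j)) :
    #J * L ≤ Fintype.card V := by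
  have h1 : #J * L ≤ ∑ j ∈ J, #(fiber π j) := by
    rw [← smul_eq_mul]
    exact card_nsmul_le_sum _ _ _ hJ
  have h2 : ∑ j ∈ J, #(fiber π j) ≤ ∑ j, #(fiber π j) :=
    sum_le_sum_of_subset (subset_univ J)
  have h3 : Fintype.card V = ∑ j, #(fiber π j) := by
    rw [← card_univ]
    exact card_eq_sum_card_fiberwise fun v _ => mem_univ (π v)
  omega

/-- The square root regime. -/
theorem hasSpanningBipartiteKConnected_of_sq {γ : ℕ} (hG : KConnected t G) (hk : 1 ≤ k)
    (hγ : 2 * k * Fintype.card V ≤ γ * γ) (ht : 5 * γ + 1 ≤ t) :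
    HasSpanningBipartiteKConnected k G := by
  have hn := hG.1
  -- Otherwise `γ < 2k` and `γ < n` would contradict `2kn ≤ γ²`.
  have hkγ : 2 * k ≤ γ := by
    by_contra! hlt
    nlinarith
  obtain ⟨π, σ, h⟩ := exists_isOptimalLabelling G k γ
  refine h.hasSpanning (by omega) ?_
  by_contra! hm
  by_cases hR : ({v | #(fiber π (π v)) ≤ 1} : Finset V).Nonempty
  · set R : Finset V := {v | #(fiber π (π v)) ≤ 1} with hRdef
    have hmemR : ∀ v, v ∈ R ↔ #(fiber π (π v)) ≤ 1 := fun v => by simp [hRdef]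
    obtain ⟨ρ, W, hWR, hWγ, hW⟩ := exists_robustlyLinked_cutGraph hk hkγ G hR (by
      intro v hv
      rw [hmemR] at hv
      let J : Finset V := {j | γ ≤ #(fiber π j)}
      have hJ := card_labels_mul_le π (J := J) fun j hj => (mem_filter.1 hj).2
      have hsplit : ({w | G.Adj v w} : Finset V) ⊆
          {w ∈ R | G.Adj v w} ∪ J.biUnion fun j => {w ∈ fiber π j | G.Adj v w} := by
        intro w hw
        simp only [mem_filter, mem_univ, true_and, mem_union, mem_biUnion, hmemR, J,
          mem_fiber] at hw ⊢
        rcases h.large (π w) with hw' | hw'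
        · exact .inl ⟨hw', hw⟩
        · exact .inr ⟨π w, hw', rfl, hw⟩
      have h1 := (card_le_card hsplit).trans (card_union_le _ _)
      have h2 : #(J.biUnion fun j => {w ∈ fiber π j | G.Adj v w}) ≤ #J * (2 * k) := by
        refine card_biUnion_le_card_mul _ _ _ fun j hj => ?_
        have hj' : γ ≤ #(fiber π j) := (mem_filter.1 hj).2
        have := h.card_neighbors_lt hk hv hj' fun e => by
          rw [e] at hv
          omega
        omega
      have h3 : #J * (2 * k) ≤ γ := by
        by_contra! hlt
        nlinarith
      have := hG.le_card_neighbors v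
      omega)
    -- Singletons constrain no colours, so recolouring `R` preserves every class.
    let σ' : V → Bool := fun v => if v ∈ R then ρ v else σ v
    have hWlab : ∀ w ∈ W, ∀ v, π v = π w → v = w := by
      intro w hw v hvw
      have : v ∈ fiber π (π w) := mem_fiber.2 hvw
      rwa [fiber_eq_singleton ((hmemR w).1 (hWR hw)), mem_singleton] at this
    have hU : classUnion π (W.image π) = W := by
      ext v
      rw [mem_classUnion, mem_image]
      constructor
      · rintro ⟨w, hw, hwv⟩
        rwa [hWlab w hw v hwv.symm]
      · exact fun hv => ⟨v, hv, rfl⟩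
    obtain ⟨a, ha, b, hb, hab⟩ := one_lt_card.1 (show 1 < #W by omega)
    refine h.not_robustlyLinked_classUnion (σ' := σ') (fun i => ?_) (mem_image_of_mem π ha)
      (mem_image_of_mem π hb) (fun e => hab (hWlab b hb a e)) (mem_image_of_mem π (mem_univ a))
      (mem_image_of_mem π (mem_univ b)) (by rw [hU]; omega) ?_
    · by_cases hi : #(fiber π i) ≤ 1
      · exact .of_card_le_one hi
      · have hnot : ∀ x ∈ fiber π i, x ∉ R := fun x hx => by
          rw [hmemR, mem_fiber.1 hx]
          exact hi
        refine (h.robust i).congr fun x hx y hy hxy => ?_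
        simpa only [σ', if_neg (hnot x hx), if_neg (hnot y hy)] using hxy
    · rw [hU]
      refine hW.congr fun x hx y hy hxy => ?_
      simpa only [σ', if_pos (hWR hx), if_pos (hWR hy)] using hxy
  · have hbig : ∀ j ∈ univ.image π, γ ≤ #(fiber π j) := by
      intro j hj
      obtain ⟨v, -, rfl⟩ := mem_image.1 hj
      refine (h.large _).resolve_left fun h1 => hR ⟨v, by simpa using h1⟩
    obtain ⟨i, hi⟩ := card_pos.1 (zero_lt_one.trans hm)
    obtain ⟨E, hE, hst, -, hcard, -⟩ := h.exists_arcs hG hk (by omega) (by omega) hm hi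
    have hm' := card_labels_mul_le π hbig
    have h1 : #E ≤ (2 * k - 2) * #(univ.image π) := by
      refine card_le_mul_card_image_of_maps_to (f := fun e => π e.2)
        (fun e _ => mem_image_of_mem π (mem_univ e.2)) _ fun j hj => ?_
      by_cases hij : i = j
      · subst hij
        rw [filter_false_of_mem fun e he => (hE e he).2.1]
        simp
      have := h.card_arcs_lt hk hij (E := {e ∈ E | π e.2 = j}) (fun e he => by
        obtain ⟨he, hej⟩ := mem_filter.1 he
        exact ⟨(hE e he).1, hej, (hE e he).2.2⟩) (hst.mono (filter_subset _ _))
        (.inl (hbig i hi))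
      omega
    -- With `m ≤ n / γ` classes, `γ² ≤ 2(k-1)mγ ≤ 2(k-1)n < 2kn ≤ γ²`.
    obtain ⟨s, rfl⟩ : ∃ s, k = s + 1 := ⟨k - 1, by omega⟩
    have h2 : 2 * (s + 1) - 2 = 2 * s := by omega
    rw [h2] at h1
    have h3 := Nat.mul_le_mul_right γ (hcard.trans h1)
    have h4 := Nat.mul_le_mul_left (2 * s) hm'
    nlinarith

end Labellings

/-! ### Choice of constants -/

theorem f_le_log {k n : ℕ} (hk : 1 ≤ k) (hkn : (k : ℝ) ≤ (n : ℝ) / 2) :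
    (f k n : ℝ) ≤ 22 * (k : ℝ) ^ 2 * Real.logb 2 (n : ℝ) := by
  have hk' : (1 : ℝ) ≤ k := by exact_mod_cast hk
  have hn : (2 : ℝ) ≤ n := by linarith
  set l : ℝ := Real.logb 2 (n : ℝ) with hl
  have hl1 : 1 ≤ l := by
    rw [hl, Real.le_logb_iff_rpow_le (by norm_num) (by linarith), Real.rpow_one]
    exact hn
  suffices ht : ⌊22 * (k : ℝ) ^ 2 * l⌋₊ ∈ goodConnectivity k n by
    have h1 : (f k n : ℝ) ≤ ⌊22 * (k : ℝ) ^ 2 * l⌋₊ := by exact_mod_cast (isLeast_f k n).2 ht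
    exact h1.trans (Nat.floor_le (by positivity))
  intro G hG
  have htlt := Nat.lt_floor_add_one (22 * (k : ℝ) ^ 2 * l)
  set t := ⌊22 * (k : ℝ) ^ 2 * l⌋₊
  rcases hk.eq_or_lt with rfl | hk2
  · refine hasSpanningBipartiteKConnected_one hG (Nat.le_floor ?_)
    push_cast
    linarith
  have hk2' : (2 : ℝ) ≤ k := by exact_mod_cast hk2
  -- In units of `q`, with `L` about `8q` and `t` about `44q` (as `22k² ≥ 44k`), the two numerical
  -- conditions become `4 ln 2 < 3` and `20 ln 2 < 33/2`.
  set q : ℝ := k * l with hq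
  have hkq : (k : ℝ) ≤ q := by rw [hq]; nlinarith
  have htq : 44 * q < t + 1 := by
    refine lt_of_le_of_lt ?_ htlt
    have : 22 * (k : ℝ) ^ 2 * l = 22 * k * q := by rw [hq]; ring
    rw [this]
    nlinarith
  have hLle := Nat.le_ceil (8 * q)
  have hLlt := Nat.ceil_lt_add_one (a := 8 * q) (by linarith)
  set L := ⌈8 * q⌉₊
  have hlog : ((k - 1 : ℕ) : ℝ) * Nat.log 2 n ≤ q - 1 := by
    have h1 : (Nat.log 2 n : ℝ) ≤ l := by
      have := Real.natLog_le_logb n 2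
      exact_mod_cast this
    rw [Nat.cast_sub hk, Nat.cast_one, hq]
    nlinarith
  have hc := Real.log_two_lt_d9
  have hc0 := Real.log_two_gt_d9
  have hlog4 : Real.log 4 = 2 * Real.log 2 := by
    rw [show (4 : ℝ) = 2 ^ 2 by norm_num, Real.log_pow]
    norm_num
  have hlogn : 2 * (k : ℝ) * Real.log n = 2 * Real.log 2 * q := by
    rw [hq, hl, Real.logb]
    field_simp
  refine hasSpanningBipartiteKConnected_of_log (L := L) hG hk ?_ ?_ ?_ ?_
  · have : ((2 * L : ℕ) : ℝ) < (t + 1 : ℕ) := by push_cast; linarith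
    exact_mod_cast this.le
  · have : ((2 * k + L : ℕ) : ℝ) < (t + 1 : ℕ) := by push_cast; linarith
    exact_mod_cast this.le
  · rw [Fintype.card_fin]
    push_cast
    rw [hlog4, hlogn]
    nlinarith
  · rw [Fintype.card_fin]
    push_cast
    rw [hlog4, hlogn]
    nlinarith

/-- Take `γ = ⌈3Q/2⌉`: then `γ² ≥ 9Q²/4 ≥ 2kn`, and `5γ + 1 < 15Q/2 + 6`. -/
theorem f_le_sq {k n : ℕ} {a Q : ℝ} (hk : 1 ≤ k) (hQ : 0 ≤ Q) (hkn : (n : ℝ) * k ≤ Q ^ 2)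
    (ha : 15 / 2 * Q + 6 ≤ a * Q) : (f k n : ℝ) ≤ a * Q := by
  suffices ht : ⌊a * Q⌋₊ ∈ goodConnectivity k n by
    have h1 : (f k n : ℝ) ≤ ⌊a * Q⌋₊ := by exact_mod_cast (isLeast_f k n).2 ht
    exact h1.trans (Nat.floor_le (by linarith))
  intro G hG
  have htlt := Nat.lt_floor_add_one (a * Q)
  have hγle := Nat.le_ceil (3 / 2 * Q)
  have hγlt := Nat.ceil_lt_add_one (a := 3 / 2 * Q) (by linarith)
  refine hasSpanningBipartiteKConnected_of_sq (γ := ⌈3 / 2 * Q⌉₊) hG hk ?_ ?_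
  · rw [Fintype.card_fin]
    have : ((2 * k * n : ℕ) : ℝ) ≤ (⌈3 / 2 * Q⌉₊ * ⌈3 / 2 * Q⌉₊ : ℕ) := by
      push_cast
      nlinarith
    exact_mod_cast this
  · have : ((5 * ⌈3 / 2 * Q⌉₊ + 1 : ℕ) : ℝ) < (⌊a * Q⌋₊ + 1 : ℕ) := by push_cast; linarith
    exact Nat.lt_succ_iff.1 (by exact_mod_cast this)

theorem theorem1 :
    (∀ k n : ℕ, 1 ≤ k → (k : ℝ) ≤ (n : ℝ) / 2 →
      (f k n : ℝ) ≤ 22 * (k : ℝ) ^ 2 * Real.logb 2 (n : ℝ)) ∧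
    (∀ α : ℝ, 0 ≤ α → α < 1 → ∃ N : ℕ, ∀ n : ℕ, N ≤ n → ∀ k : ℕ, k = ⌊(n : ℝ) ^ α⌋₊ →
      (f k n : ℝ) ≤ 9 * (n : ℝ) ^ ((1 + α) / 2) ∧
      9 * (n : ℝ) ^ ((1 + α) / 2) ≤ 9 * Real.sqrt ((n : ℝ) * ((k : ℝ) + 1))) ∧
    (∀ c : ℝ, 0 < c → c < 1 / 2 → ∃ N : ℕ, ∀ n : ℕ, N ≤ n → ∀ k : ℕ, k = ⌊c * (n : ℝ)⌋₊ →
      (f k n : ℝ) ≤ 30 * Real.sqrt c * (n : ℝ) ∧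
      30 * Real.sqrt c * (n : ℝ) ≤ 30 * Real.sqrt ((n : ℝ) * ((k : ℝ) + 1))) := by
  -- The factor 9 needs `Q ≥ 4`, and `n ≥ 25` gives `Q ≥ 5`; the factor 30 needs only `Q ≥ 1`, which
  -- follows from `cn ≥ 1`.
  refine ⟨fun k n => f_le_log, fun α hα0 _ => ⟨25, ?_⟩, fun c hc0 _ => ⟨⌈1 / c⌉₊ + 1, ?_⟩⟩
  · rintro n hn k rfl
    have hn' : (25 : ℝ) ≤ n := by exact_mod_cast hn
    have hn0 : (0 : ℝ) < n := by linarith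
    have hx1 : 1 ≤ (n : ℝ) ^ α := Real.one_le_rpow (by linarith) hα0
    have hfl := Nat.floor_le (zero_le_one.trans hx1)
    have hlt := Nat.lt_floor_add_one ((n : ℝ) ^ α)
    have hQ0 : 0 ≤ (n : ℝ) ^ ((1 + α) / 2) := by positivity
    have hQ : ((n : ℝ) ^ ((1 + α) / 2)) ^ 2 = n * (n : ℝ) ^ α := by
      rw [← Real.rpow_natCast, ← Real.rpow_mul hn0.le, ← Real.rpow_one_add' hn0.le (by linarith)]
      congr 1
      push_cast
      ring
    refine ⟨f_le_sq (Nat.le_floor (by simpa using hx1)) hQ0 ?_ ?_, ?_⟩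
    · rw [hQ]; gcongr
    · nlinarith
    · refine mul_le_mul_of_nonneg_left (Real.le_sqrt_of_sq_le ?_) (by norm_num)
      rw [hQ]; gcongr
  · rintro n hn k rfl
    have hcn : 1 ≤ c * n := by
      have h1 : 1 / c ≤ n := (Nat.le_ceil _).trans (by exact_mod_cast (Nat.le_succ _).trans hn)
      rwa [div_le_iff₀ hc0, mul_comm] at h1
    have hn1 : (1 : ℝ) ≤ n := by exact_mod_cast (Nat.le_add_left _ _).trans hn
    have hfl := Nat.floor_le (zero_le_one.trans hcn)
    have hlt := Nat.lt_floor_add_one (c * n)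
    have hQ0 : 0 ≤ Real.sqrt c * n := by positivity
    have hQ : (Real.sqrt c * n) ^ 2 = n * (c * n) := by
      rw [mul_pow, Real.sq_sqrt hc0.le]
      ring
    rw [mul_assoc]
    refine ⟨f_le_sq (Nat.le_floor (by simpa using hcn)) hQ0 ?_ ?_, ?_⟩
    · rw [hQ]; gcongr
    · nlinarith
    · refine mul_le_mul_of_nonneg_left (Real.le_sqrt_of_sq_le ?_) (by norm_num)
      rw [hQ]; gcongr
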